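/- Let $G=(V,E)$ be a finite connected graph with $|V|\ge 2$; parallel edges are allowed, loops are not. A \emph{two-forest} of $G$ is a subgraph of $G$ that contains all vertices of $G$, contains no cycles, and has exactly two connected components. The \emph{cut set} $\partial F$ of a two-forest $F$ is the set of edges of $G$ that have one endpoint in each component of $F$. Let $\mathrm{avg.deg}=\frac1{|V|}\sum_{v\in V}\deg v$ be the average degree of $G$. Then $\mathrm{avg.deg}=2|E|/|V|$, the graph $G$ has at least one two-forest, and if $F$ is a two-forest of $G$ chosen uniformly at random, then \[ \mathbb{E}\bigl(|\partial F|\bigr)=\frac{\sum_{F}|\partial F|}{\#\{\text{two-forests of }G\}}\;\le\; 2\,(\mathrm{avg.deg})\left(1+\frac{1}{|V|-1}\right), \] where the sum runs over all two-forests $F$ of $G$. -/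

import Mathlib

namespace TwoForest

variable {α β : Type*}

/-- Two vertices are joined by a (possibly trivial) path of `G`. -/
def Reachable (G : Graph α β) : α → α → Prop :=
  Relation.ReflTransGen G.Adj

/-- A multigraph is connected if it has a vertex and any two of its vertices are joined
by a path. -/
def Connected (G : Graph α β) : Prop :=
  G.vertexSet.Nonempty ∧ ∀ u ∈ G.vertexSet, ∀ v ∈ G.vertexSet, Reachable G u v

/-- `G` contains a cycle: for some `n ≥ 0` there are `n + 1` distinct vertices
`v 0, …, v n` and `n + 1` distinct edges `e 0, …, e n` such that `e i` joins `v i` to `v (i + 1)`,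
indices being read modulo `n + 1`.  (A loop is a cycle with `n = 0`, and a pair of parallel edges
is a cycle with `n = 1`.) -/
def HasCycle (G : Graph α β) : Prop :=
  ∃ (n : ℕ) (v : Fin (n + 1) → α) (e : Fin (n + 1) → β),
    Function.Injective v ∧ Function.Injective e ∧ ∀ i, G.IsLink (e i) (v i) (v (i + 1))

/-- The vertex sets of the connected components of `G`. -/
def components (G : Graph α β) : Set (Set α) :=
  {C | ∃ x ∈ G.vertexSet, C = {y | Reachable G x y}}

/-- The two-forests of `G`: the subgraphs that contain all vertices of `G`, contain no cycles,
and have exactly two connected components. -/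
def twoForests (G : Graph α β) : Set (Graph α β) :=
  {F | F.IsSpanningSubgraph G ∧ ¬ HasCycle F ∧ (components F).ncard = 2}

/-- The cut set `∂F`: the edges of `G` whose endpoints lie in different components of `F`. -/
def cutSet (G F : Graph α β) : Set β :=
  {e | ∃ A ∈ components F, ∃ B ∈ components F, A ≠ B ∧ ∃ u ∈ A, ∃ v ∈ B, G.IsLink e u v}

/-- The expectation of `|∂F|` when `F` has the uniform distribution on the two-forests of `G`.
For a finite graph the sum and the cardinalities are those of finite sets,
see `twoForests_finite`. -/
noncomputable def expectedCutSize (G : Graph α β) : ℝ :=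
  (∑ᶠ F ∈ twoForests G, ((cutSet G F).ncard : ℝ)) / ((twoForests G).ncard : ℝ)

/-- The degree of a vertex of a graph without loops: the number of edges incident to it. -/
noncomputable def degree (G : Graph α β) (v : α) : ℕ :=
  {e | G.Inc e v}.ncard

/-- The average degree of the vertices of `G`. -/
noncomputable def avgDegree (G : Graph α β) : ℝ :=
  (∑ᶠ v ∈ G.vertexSet, (degree G v : ℝ)) / (G.vertexSet.ncard : ℝ)

/-- A graph with finitely many edges has finitely many two-forests. -/
theorem twoForests_finite (G : Graph α β) (hE : G.edgeSet.Finite) : (twoForests G).Finite := by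
  refine Set.Finite.of_finite_image (f := fun F : Graph α β => F.edgeSet)
    (hE.finite_subsets.subset ?_) ?_
  · rintro _ ⟨F, hF, rfl⟩
    exact hF.1.le.edgeSet_mono
  · intro F hF H hH h
    exact (Graph.Compatible.of_le_le hF.1.le hH.1.le).ext
      (hF.1.vertexSet_eq.trans hH.1.vertexSet_eq.symm) h

end TwoForest

/-! Let n = |V|, and let τ and τ₂ count spanning trees and two-forests. Adding a cut edge to a
two-forest gives a spanning tree with a marked edge, bijectively, so the cut sizes sum to (n - 1)τ
(`sum_card_cut`). The claim becomes (n - 1)²τ ≤ 4|E|τ₂ (`card_sub_one_sq_mul_le`).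

Ground a vertex x and let h be the Green function. By the matrix-tree theorem
(`det_groundedLaplacian`), τ·h(v,v) and τ times a 2×2 principal minor of h count the forests rooted
at {x,v} and {x,u,v}. In a two-forest the component avoiding x has one more vertex than edges.
Summing this over all two-forests gives τ₂/τ = ∑_v h(v,v) - ∑_e (ab - c²), where a, b are the
diagonal values of h at the ends of e and c is the mixed value.

The trace identity `IsGreen.sum_trace` rewrites ∑_v h(v,v) as ∑_e (a(a - c) + b(b - c)), and then
each edge contributes at least r²/4, where r = a + b - 2c is its effective resistance. Foster's
identity ∑ r = n - 1 and Cauchy–Schwarz conclude.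

Forests are encoded by spanning together with an edge count instead of acyclicity. Since no smaller
edge set spans (`Spans.card_le`), acyclicity and separation of the roots follow by counting. -/

namespace EdgeEnds

open Finset Relation

/-! ### Paths and rooted forests -/

variable {V E : Type*} (s t : E → V)

/-- The edge `e` joins `a` and `b`, where `s e` and `t e` are the two ends of `e`. -/
def Link (e : E) (a b : V) : Prop :=
  s e = a ∧ t e = b ∨ s e = b ∧ t e = a

/-- `a` and `b` are joined by a path with edges in `S`. -/
def Joined (S : Finset E) : V → V → Prop :=
  ReflTransGen fun a b => ∃ e ∈ S, Link s t e a b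

/-- Every vertex is joined by edges of `S` to a vertex of `R`. -/
def Spans (S : Finset E) (R : Finset V) : Prop :=
  ∀ v, ∃ r ∈ R, Joined s t S v r

/-- `S` is a spanning forest each of whose components contains exactly one vertex of `R`. -/
def IsRootedForest [Fintype V] (S : Finset E) (R : Finset V) : Prop :=
  Spans s t S R ∧ S.card + R.card = Fintype.card V

variable {s t}

theorem Link.symm {e : E} {a b : V} (h : Link s t e a b) : Link s t e b a := Or.symm h

theorem link_self (e : E) : Link s t e (s e) (t e) := Or.inl ⟨rfl, rfl⟩

theorem Joined.symm {S : Finset E} {a b : V} (h : Joined s t S a b) : Joined s t S b a := by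
  induction h with
  | refl => exact .refl
  | tail _ hl ih =>
    obtain ⟨e, he, hl⟩ := hl
    exact ReflTransGen.head ⟨e, he, hl.symm⟩ ih

theorem Joined.trans {S : Finset E} {a b c : V} (h : Joined s t S a b) (h' : Joined s t S b c) :
    Joined s t S a c :=
  ReflTransGen.trans h h'

theorem Joined.mono {S T : Finset E} (hST : S ⊆ T) {a b : V} (h : Joined s t S a b) :
    Joined s t T a b :=
  ReflTransGen.mono (fun _ _ ⟨e, he, hl⟩ => ⟨e, hST he, hl⟩) a b h

theorem Joined.single {S : Finset E} {e : E} (he : e ∈ S) {a b : V} (h : Link s t e a b) :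
    Joined s t S a b :=
  ReflTransGen.single ⟨e, he, h⟩

theorem Spans.mono {S T : Finset E} {R : Finset V} (hST : S ⊆ T) (h : Spans s t S R) :
    Spans s t T R := fun v => by
  obtain ⟨r, hr, h⟩ := h v
  exact ⟨r, hr, h.mono hST⟩

theorem Spans.of_joined {S : Finset E} {R Q : Finset V} (h : Spans s t S R)
    (hR : ∀ r ∈ R, ∃ q ∈ Q, Joined s t S r q) : Spans s t S Q := fun v => by
  obtain ⟨r, hr, h⟩ := h v
  obtain ⟨q, hq, h'⟩ := hR r hr
  exact ⟨q, hq, h.trans h'⟩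

/-- Every vertex outside `R` has an edge of `S` leading closer to `R`. -/
theorem Spans.exists_parent {S : Finset E} {R : Finset V} (h : Spans s t S R) :
    ∃ (rk : V → ℕ) (p : {v // v ∉ R} → E),
      ∀ v, p v ∈ S ∧ ∃ w, Link s t (p v) v w ∧ rk w < rk v := by
  classical
  -- `D k` consists of the vertices with a walk of length exactly `k` to `R`; the rank is the least
  -- such `k`, and rank 0 means lying in `R`.
  let D : ℕ → Set V := fun k =>
    Nat.rec (motive := fun _ => Set V) (↑R) (fun _ A => {v | ∃ e ∈ S, ∃ w ∈ A, Link s t e v w}) k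
  have hD : ∀ v, ∃ k : ℕ, v ∈ D k := fun v => by
    obtain ⟨r, hr, h⟩ := h v
    induction h using ReflTransGen.head_induction_on with
    | refl => exact ⟨0, hr⟩
    | head h _ ih =>
      obtain ⟨e, he, hl⟩ := h
      obtain ⟨k, hk⟩ := ih
      exact ⟨k + 1, e, he, _, hk, hl⟩
  have hp : ∀ v : {v // v ∉ R}, ∃ e ∈ S, ∃ w : V, Link s t e v w ∧
      sInf {k | w ∈ D k} < sInf {k | v.1 ∈ D k} := by
    rintro ⟨v, hv⟩
    have hs : v ∈ D (sInf {k | v ∈ D k}) := Nat.sInf_mem (hD v)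
    rcases hk : sInf {k | v ∈ D k} with _ | k
    · rw [hk] at hs
      exact absurd hs hv
    · rw [hk] at hs
      obtain ⟨e, he, w, hw, hl⟩ := hs
      exact ⟨e, he, w, hl, Nat.lt_succ_of_le (Nat.sInf_le hw)⟩
  choose p hp using hp
  exact ⟨fun v => sInf {k | v ∈ D k}, p, fun v => ⟨(hp v).1, (hp v).2⟩⟩

/-- Two distinct vertices with the same parent edge would be its two ends, and each would have
smaller rank than the other. -/
theorem parent_injective {R : Finset V} {rk : V → ℕ} {p : {v // v ∉ R} → E}
    (hp : ∀ v, ∃ w, Link s t (p v) v w ∧ rk w < rk v) : Function.Injective p := by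
  intro v v' h
  obtain ⟨w, hl, hr⟩ := hp v
  obtain ⟨w', hl', hr'⟩ := hp v'
  rw [← h] at hl'
  rcases hl with ⟨h1, h2⟩ | ⟨h1, h2⟩ <;> rcases hl' with ⟨h3, h4⟩ | ⟨h3, h4⟩
  · exact Subtype.ext (h1.symm.trans h3)
  · rw [← h1, h3] at hr
    rw [← h4, h2] at hr'
    omega
  · rw [← h1, h3] at hr
    rw [← h4, h2] at hr'
    omega
  · exact Subtype.ext (h2.symm.trans h4)

/-- A path either avoids the edge `e` or its initial part reaches an end of `e` avoiding `e`. -/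
theorem Joined.erase [DecidableEq E] {S : Finset E} {a b : V} (h : Joined s t S a b) (e : E) :
    Joined s t (S.erase e) a b ∨ Joined s t (S.erase e) a (s e) ∨
      Joined s t (S.erase e) a (t e) := by
  induction h using ReflTransGen.head_induction_on with
  | refl => exact Or.inl .refl
  | @head a c h _ ih =>
    obtain ⟨e', he', hl⟩ := h
    by_cases hee : e' = e
    · subst hee
      rcases hl with ⟨h1, -⟩ | ⟨-, h1⟩
      · exact Or.inr (Or.inl (h1 ▸ .refl))
      · exact Or.inr (Or.inr (h1 ▸ .refl))
    · have hs := Joined.single (mem_erase.2 ⟨hee, he'⟩) hl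
      exact ih.imp hs.trans (Or.imp hs.trans hs.trans)

theorem joined_iff_erase_of_joined [DecidableEq E] {S : Finset E} {e : E}
    (h : Joined s t (S.erase e) (s e) (t e))
    {a b : V} : Joined s t S a b ↔ Joined s t (S.erase e) a b := by
  refine ⟨fun hj => ?_, Joined.mono (erase_subset _ _)⟩
  induction hj with
  | refl => exact .refl
  | tail _ hl ih =>
    obtain ⟨e', he', hl⟩ := hl
    refine ih.trans ?_
    by_cases hee : e' = e
    · subst hee
      rcases hl with ⟨rfl, rfl⟩ | ⟨rfl, rfl⟩
      exacts [h, h.symm]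
    · exact Joined.single (mem_erase.2 ⟨hee, he'⟩) hl

/-- A path to `R` can be stopped when it first meets an end of `e`, since both ends reach `R`
without `e`. -/
theorem Spans.erase_edge [DecidableEq E] {S : Finset E} {R : Finset V} (h : Spans s t S R) {e : E}
    {a b : V}
    (hl : Link s t e a b) (ha : a ∈ R) (hb : ∃ r ∈ R, Joined s t (S.erase e) b r) :
    Spans s t (S.erase e) R := fun v => by
  obtain ⟨r, hr, hj⟩ := h v
  obtain ⟨q, hq, hbq⟩ := hb
  rcases hj.erase e with h | h | h
  · exact ⟨r, hr, h⟩
  all_goals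
    rcases hl with ⟨rfl, rfl⟩ | ⟨rfl, rfl⟩
    · first | exact ⟨_, ha, h⟩ | exact ⟨q, hq, h.trans hbq⟩
    · first | exact ⟨_, ha, h⟩ | exact ⟨q, hq, h.trans hbq⟩

section Finite

variable [Fintype V]

theorem card_compl_subtype (R : Finset V) [Fintype {v // v ∉ R}] :
    Fintype.card {v // v ∉ R} + R.card = Fintype.card V := by
  classical
  rw [Fintype.card_subtype_compl, Fintype.card_coe]
  have := R.card_le_univ
  omega

/-- The parent edges suffice: they lead down in rank to `R`, and there is exactly one for each
non-root. -/
theorem Spans.exists_isRootedForest {S : Finset E} {R : Finset V} (h : Spans s t S R) :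
    ∃ T ⊆ S, IsRootedForest s t T R := by
  classical
  obtain ⟨rk, p, hp⟩ := h.exists_parent
  have hinj := parent_injective fun v => (hp v).2
  refine ⟨univ.image p, fun e he => ?_, ?_, ?_⟩
  · obtain ⟨v, -, rfl⟩ := mem_image.1 he
    exact (hp v).1
  · intro v
    induction hk : rk v using Nat.strong_induction_on generalizing v with
    | _ k ih =>
      by_cases hv : v ∈ R
      · exact ⟨v, hv, .refl⟩
      obtain ⟨w, hl, hr⟩ := (hp ⟨v, hv⟩).2
      obtain ⟨r, hr, hj⟩ := ih _ (hk ▸ hr) w rfl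
      exact ⟨r, hr, (Joined.single (mem_image_of_mem _ (mem_univ _)) hl).trans hj⟩
  · rw [card_image_of_injective _ hinj, card_univ, card_compl_subtype]

theorem Spans.card_le {S : Finset E} {R : Finset V} (h : Spans s t S R) :
    Fintype.card V ≤ S.card + R.card := by
  obtain ⟨T, hT, h⟩ := h.exists_isRootedForest
  rw [← h.2]
  have := card_le_card hT
  omega

/-- Every edge of a forest is a bridge. -/
theorem IsRootedForest.not_joined_erase [DecidableEq E] {S : Finset E} {R : Finset V}
    (h : IsRootedForest s t S R) {e : E} (he : e ∈ S) :
    ¬ Joined s t (S.erase e) (s e) (t e) := fun hj => by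
  have h1 : Spans s t (S.erase e) R := fun v => by
    obtain ⟨r, hr, h⟩ := h.1 v
    exact ⟨r, hr, (joined_iff_erase_of_joined hj).1 h⟩
  have h2 := h1.card_le
  have h3 := card_erase_add_one he
  have h4 := h.2
  omega

/-- An edge of `S` outside a rooted forest `T ⊆ S` has its ends joined within `T`, as distinct roots
are not joined in `S`; so it is not a bridge. -/
theorem isRootedForest_of_bridges [DecidableEq E] {S : Finset E} {R : Finset V} (h : Spans s t S R)
    (hR : ∀ a ∈ R, ∀ b ∈ R, Joined s t S a b → a = b)
    (hS : ∀ e ∈ S, ¬ Joined s t (S.erase e) (s e) (t e)) : IsRootedForest s t S R := by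
  obtain ⟨T, hT, hF⟩ := h.exists_isRootedForest
  suffices T = S from this ▸ hF
  refine hT.antisymm fun e he => ?_
  by_contra heT
  have hTe : T ⊆ S.erase e := subset_erase.2 ⟨hT, heT⟩
  obtain ⟨a, ha, h1⟩ := hF.1 (s e)
  obtain ⟨b, hb, h2⟩ := hF.1 (t e)
  have := hR a ha b hb (((h1.mono hT).symm.trans (Joined.single he (link_self e))).trans
    (h2.mono hT))
  subst this
  exact hS e he ((h1.trans h2.symm).mono hTe)

variable [DecidableEq V]

/-- If two roots were joined, one could be dropped, and `S` would have too few edges to span. -/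
theorem IsRootedForest.eq_of_joined {S : Finset E} {R : Finset V} (h : IsRootedForest s t S R)
    {a b : V} (ha : a ∈ R) (hb : b ∈ R) (hj : Joined s t S a b) : a = b := by
  by_contra hab
  have h1 : Spans s t S (R.erase a) := h.1.of_joined fun r hr => by
    by_cases hra : r = a
    · exact ⟨b, by simp [hb, Ne.symm hab], hra ▸ hj⟩
    · exact ⟨r, by simp [hr, hra], .refl⟩
  have h2 := h1.card_le
  have h3 := card_erase_add_one ha
  have h4 := h.2
  omega

/-- Removing an edge from a root `u` of a forest to another vertex `v` makes `v` a root. -/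
theorem IsRootedForest.erase_edge [DecidableEq E] {S : Finset E} {R : Finset V}
    (h : IsRootedForest s t S R)
    {e : E} {u v : V} (hl : Link s t e u v) (hu : u ∈ R) (hv : v ∉ R) (he : e ∈ S) :
    IsRootedForest s t (S.erase e) (insert v R) := by
  refine ⟨Spans.erase_edge (h.1.of_joined fun r hr => ⟨r, mem_insert_of_mem hr, .refl⟩) hl
    (mem_insert_of_mem hu) ⟨v, mem_insert_self _ _, .refl⟩, ?_⟩
  rw [card_insert_of_notMem hv, ← h.2, ← card_erase_add_one he]
  omega

theorem IsRootedForest.notMem {S : Finset E} {R : Finset V} (h : IsRootedForest s t S R)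
    {e : E} {u v : V} (hl : Link s t e u v) (hu : u ∈ R) (hv : v ∈ R) (huv : u ≠ v) : e ∉ S :=
  fun he => huv (h.eq_of_joined hu hv (Joined.single he hl))

/-- Adding an edge between two roots `u` and `v` of a forest makes `v` cease to be a root. -/
theorem IsRootedForest.insert_edge [DecidableEq E] {S : Finset E} {R : Finset V} {e : E} {u v : V}
    (h : IsRootedForest s t S (insert v R)) (hl : Link s t e u v) (hu : u ∈ R) (hv : v ∉ R) :
    IsRootedForest s t (insert e S) R := by
  have he : e ∉ S := h.notMem hl (mem_insert_of_mem hu) (mem_insert_self _ _)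
    fun h => hv (h ▸ hu)
  refine ⟨Spans.of_joined (h.1.mono (subset_insert e S)) fun r hr => ?_, ?_⟩
  · rcases mem_insert.1 hr with rfl | hr
    · exact ⟨u, hu, Joined.single (mem_insert_self _ _) hl.symm⟩
    · exact ⟨r, hr, .refl⟩
  · have := h.2
    rw [card_insert_of_notMem hv] at this
    rw [card_insert_of_notMem he]
    omega

end Finite

end EdgeEnds

/-! ### The matrix-tree theorem by deletion and grounding -/

namespace EdgeEnds

open Finset Relation

section MatrixTree

variable {V E : Type*} (s t : E → V)

/-- The spanning forests with edges in `S` and exactly one root from `R` in each component. -/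
noncomputable def rootedForests [Fintype V] (S : Finset E) (R : Finset V) : Finset (Finset E) :=
  open Classical in S.powerset.filter fun T => IsRootedForest s t T R

/-- The signed incidence of an edge and a vertex. -/
def incidence [DecidableEq V] (e : E) (a : V) : ℝ :=
  (if s e = a then 1 else 0) - (if t e = a then 1 else 0)

/-- The Laplacian of the graph with edge set `S`, with the rows of the vertices of `R` replaced
by those of the identity matrix. -/
def groundedLaplacian [DecidableEq V] (S : Finset E) (R : Finset V) : Matrix V V ℝ :=
  Matrix.of fun a b => if a ∈ R then (if a = b then 1 else 0) else
    ∑ e ∈ S, incidence s t e a * incidence s t e b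

variable {s t}

theorem mem_rootedForests [Fintype V] {S T : Finset E} {R : Finset V} :
    T ∈ rootedForests s t S R ↔ T ⊆ S ∧ IsRootedForest s t T R := by
  simp [rootedForests]

theorem sum_incidence_mul [Fintype V] [DecidableEq V] (e : E) (f : V → ℝ) :
    ∑ a, incidence s t e a * f a = f (s e) - f (t e) := by
  simp [incidence, sub_mul, Finset.sum_sub_distrib]

theorem incidence_eq_zero [DecidableEq V] {e : E} {a b c : V} (hl : Link s t e a b) (ha : c ≠ a)
    (hb : c ≠ b) :
    incidence s t e c = 0 := by
  rcases hl with ⟨rfl, rfl⟩ | ⟨rfl, rfl⟩ <;> simp [incidence, ha.symm, hb.symm]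

theorem incidence_mul [DecidableEq V] {e : E} {a b : V} (hl : Link s t e a b) (hab : a ≠ b)
    (c : V) :
    incidence s t e a * incidence s t e c = (if a = c then 1 else 0) - (if b = c then 1 else 0) := by
  rcases hl with ⟨rfl, rfl⟩ | ⟨rfl, rfl⟩ <;> simp [incidence, hab.symm]

variable [Fintype V]

theorem card_rootedForests_of_no_crossing {S : Finset E} {R : Finset V} (hR : R ≠ univ)
    (h : ∀ e ∈ S, ∀ u ∈ R, ∀ v ∉ R, ¬ Link s t e u v) : rootedForests s t S R = ∅ := by
  rw [eq_empty_iff_forall_notMem]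
  intro T hT
  rw [mem_rootedForests] at hT
  obtain ⟨v, hv⟩ : ∃ v, v ∉ R := by simpa [eq_univ_iff_forall] using hR
  obtain ⟨r, hr, hj⟩ := hT.2.1 v
  suffices v ∈ R from hv this
  induction hj using ReflTransGen.head_induction_on with
  | refl => exact hr
  | @head a b hl _ ih =>
    obtain ⟨e, he, hl⟩ := hl
    by_contra ha
    refine h e (hT.1 he) b ?_ a ha hl.symm
    by_contra hb
    exact hb (ih hb)

variable [DecidableEq V]

theorem det_groundedLaplacian_of_no_crossing {S : Finset E} {R : Finset V} (hR : R ≠ univ)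
    (h : ∀ e ∈ S, ∀ u ∈ R, ∀ v ∉ R, ¬ Link s t e u v) : (groundedLaplacian s t S R).det = 0 := by
  obtain ⟨v, hv⟩ : ∃ v, v ∉ R := by simpa [eq_univ_iff_forall] using hR
  -- With no edge leaving `R`, the indicator of the complement of `R` lies in the kernel.
  refine Matrix.exists_mulVec_eq_zero_iff.1 ⟨fun a => if a ∈ R then 0 else 1, fun h0 => ?_, ?_⟩
  · simpa [hv] using congrFun h0 v
  · ext a
    rw [Matrix.mulVec, dotProduct]
    by_cases ha : a ∈ R
    · refine sum_eq_zero fun b _ => ?_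
      by_cases hb : b ∈ R
      · simp [hb]
      · have hab : a ≠ b := fun h => hb (h ▸ ha)
        simp [groundedLaplacian, ha, hab]
    · simp only [groundedLaplacian, Matrix.of_apply, if_neg ha, sum_mul, Pi.zero_apply]
      rw [sum_comm]
      refine sum_eq_zero fun e he => ?_
      simp_rw [mul_assoc]
      rw [← mul_sum, sum_incidence_mul]
      by_cases h1 : s e ∈ R <;> by_cases h2 : t e ∈ R
      · simp [h1, h2]
      · exact absurd (link_self e) (h e he _ h1 _ h2)
      · exact absurd (link_self e).symm (h e he _ h2 _ h1)
      · simp [h1, h2]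

variable [DecidableEq E]

/-- Forests containing an edge from a root `u` to a non-root `v` correspond to forests in which
`v` is an additional root. -/
theorem card_filter_mem_rootedForests {S : Finset E} {R : Finset V} {e : E} (he : e ∈ S) {u v : V}
    (hu : u ∈ R) (hv : v ∉ R) (hl : Link s t e u v) :
    ((rootedForests s t S R).filter fun T => e ∈ T).card =
      (rootedForests s t S (insert v R)).card := by
  have huv : u ≠ v := fun h => hv (h ▸ hu)
  refine card_nbij' (fun T => T.erase e) (fun T => insert e T) ?_ ?_ ?_ ?_
  · intro T hT
    simp only [coe_filter, mem_rootedForests, Set.mem_ofPred_eq] at hT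
    simp only [mem_coe, mem_rootedForests]
    exact ⟨(erase_subset _ _).trans hT.1.1, hT.1.2.erase_edge hl hu hv hT.2⟩
  · intro T hT
    simp only [mem_coe, mem_rootedForests] at hT
    simp only [coe_filter, mem_rootedForests, Set.mem_ofPred_eq]
    exact ⟨⟨insert_subset he hT.1, hT.2.insert_edge hl hu hv⟩, mem_insert_self _ _⟩
  · intro T hT
    simp only [coe_filter, Set.mem_ofPred_eq] at hT
    exact insert_erase hT.2
  · intro T hT
    simp only [mem_coe, mem_rootedForests] at hT
    exact erase_insert (hT.2.notMem hl (mem_insert_of_mem hu) (mem_insert_self _ _) huv)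

/-- Deletion–contraction, with contraction of `e` into the roots modelled by making `v` a root; the
vertex set never changes. -/
theorem card_rootedForests_of_crossing {S : Finset E} {R : Finset V} {e : E} (he : e ∈ S) {u v : V}
    (hu : u ∈ R) (hv : v ∉ R) (hl : Link s t e u v) :
    (rootedForests s t S R).card = (rootedForests s t (S.erase e) R).card +
      (rootedForests s t (S.erase e) (insert v R)).card := by
  have huv : u ≠ v := fun h => hv (h ▸ hu)
  rw [← card_filter_add_card_filter_not (s := rootedForests s t S R) (fun T => e ∉ T)]
  congr 1
  · congr 1
    ext T
    simp only [mem_filter, mem_rootedForests, subset_erase]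
    tauto
  · simp only [not_not]
    rw [card_filter_mem_rootedForests he hu hv hl]
    congr 1
    ext T
    simp only [mem_rootedForests, subset_erase]
    exact ⟨fun h => ⟨⟨h.1, h.2.notMem hl (mem_insert_of_mem hu) (mem_insert_self _ _) huv⟩, h.2⟩,
      fun h => ⟨h.1.1, h.2⟩⟩

/-- As row `u` is grounded, `e` alters only row `v`, by δ_v - δ_u. The determinant is linear in that
row, and δ_u is removed by adding row `u`, which equals δ_u. The recursion is the same as for the
forest counts. -/
theorem det_groundedLaplacian_of_crossing {S : Finset E} {R : Finset V} {e : E} (he : e ∈ S)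
    {u v : V} (hu : u ∈ R) (hv : v ∉ R) (hl : Link s t e u v) :
    (groundedLaplacian s t S R).det = (groundedLaplacian s t (S.erase e) R).det +
      (groundedLaplacian s t (S.erase e) (insert v R)).det := by
  have huv : u ≠ v := fun h => hv (h ▸ hu)
  set M := groundedLaplacian s t (S.erase e) R with hM
  have h1 : groundedLaplacian s t S R =
      M.updateRow v (M v + (Pi.single v 1 - Pi.single u 1)) := by
    ext a b
    by_cases hav : a = v
    · subst hav
      simp only [Matrix.updateRow_self, hM, groundedLaplacian, Matrix.of_apply, if_neg hv,
        Pi.add_apply, Pi.sub_apply, ← add_sum_erase S _ he, incidence_mul hl.symm huv.symm,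
        Pi.single_apply]
      simp only [eq_comm]
      ring
    · rw [Matrix.updateRow_ne hav]
      simp only [hM, groundedLaplacian, Matrix.of_apply]
      split_ifs with h1 h2
      · rfl
      · rfl
      · rw [← add_sum_erase S _ he,
          incidence_eq_zero hl (fun h : a = u => h1 (h.symm ▸ hu)) hav, zero_mul, zero_add]
  have h2 : groundedLaplacian s t (S.erase e) (insert v R) = M.updateRow v (Pi.single v 1) := by
    ext a b
    by_cases hav : a = v
    · subst hav
      simp [groundedLaplacian, Pi.single_apply, eq_comm]
    · rw [Matrix.updateRow_ne hav]
      simp [hM, groundedLaplacian, hav]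
  have h3 : M u = Pi.single u 1 := by
    ext b
    simp [hM, groundedLaplacian, hu, Pi.single_apply, eq_comm]
  have h4 := Matrix.det_updateRow_add_smul_self
    (M.updateRow v (Pi.single v 1 - Pi.single u 1)) huv.symm 1
  rw [h1, Matrix.det_updateRow_add, Matrix.updateRow_eq_self, h2, ← h4]
  congr 2
  simp [Matrix.updateRow_ne huv, h3]

/-- The matrix-tree theorem for principal minors of the Laplacian. -/
theorem det_groundedLaplacian (S : Finset E) (R : Finset V) :
    (groundedLaplacian s t S R).det = (rootedForests s t S R).card := by
  induction S using Finset.strongInduction generalizing R with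
  | H S ih =>
    by_cases hR : R = univ
    · subst hR
      have h1 : groundedLaplacian s t S univ = 1 := by
        ext a b
        simp [groundedLaplacian, Matrix.one_apply]
      have h2 : rootedForests s t S univ = {∅} := by
        ext T
        rw [mem_rootedForests, IsRootedForest, mem_singleton, card_univ]
        constructor
        · rintro ⟨-, -, h⟩
          exact card_eq_zero.1 (by omega)
        · rintro rfl
          exact ⟨empty_subset _, fun v => ⟨v, mem_univ _, .refl⟩, by simp⟩
      simp [h1, h2]
    by_cases h : ∀ e ∈ S, ∀ u ∈ R, ∀ v ∉ R, ¬ Link s t e u v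
    · rw [det_groundedLaplacian_of_no_crossing hR h, card_rootedForests_of_no_crossing hR h]
      simp
    · push Not at h
      obtain ⟨e, he, u, hu, v, hv, hl⟩ := h
      rw [det_groundedLaplacian_of_crossing he hu hv hl,
        card_rootedForests_of_crossing he hu hv hl,
        ih _ (erase_ssubset he), ih _ (erase_ssubset he), Nat.cast_add]

end MatrixTree

end EdgeEnds

/-! ### The Green function and its minors -/

namespace EdgeEnds

open Finset Relation

section Green

variable {V E : Type*} (s t : E → V)

/-- `h` is the Green function of the graph Laplacian with a Dirichlet condition at `x`. -/
structure IsGreen [Fintype V] [DecidableEq V] [Fintype E] (x : V) (h : V → V → ℝ) : Prop where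
  left_zero : ∀ v, h x v = 0
  right_zero : ∀ v, h v x = 0
  reproducing : ∀ f : V → ℝ, f x = 0 → ∀ v,
    f v = ∑ e, (f (s e) - f (t e)) * (h (s e) v - h (t e) v)
  diag : ∀ v, v ≠ x →
    ((rootedForests s t univ {x}).card : ℝ) * h v v = (rootedForests s t univ {x, v}).card
  minor : ∀ u v, u ≠ x → v ≠ x → u ≠ v →
    ((rootedForests s t univ {x}).card : ℝ) * (h u u * h v v - h u v * h v u) =
      (rootedForests s t univ {x, u, v}).card

variable {s t}

theorem groundedLaplacian_insert [DecidableEq V] (S : Finset E) (R : Finset V) (v : V) :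
    groundedLaplacian s t S (insert v R) =
      (groundedLaplacian s t S R).updateRow v (Pi.single v 1) := by
  ext a b
  by_cases hav : a = v
  · subst hav
    simp [groundedLaplacian, Pi.single_apply, eq_comm]
  · rw [Matrix.updateRow_ne hav]
    simp [groundedLaplacian, hav]

/-- The matrix is a rank-two perturbation 1 + PQ of the identity, and det(1 + PQ) = det(1 + QP)
reduces to size two. -/
theorem det_one_updateRow_updateRow [Fintype V] [DecidableEq V] {u v : V} (huv : u ≠ v)
    (a b : V → ℝ) :
    (((1 : Matrix V V ℝ).updateRow u a).updateRow v b).det = a u * b v - a v * b u := by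
  let P : Matrix V (Fin 2) ℝ := Matrix.of fun w => ![if w = u then 1 else 0, if w = v then 1 else 0]
  let Q : Matrix (Fin 2) V ℝ := Matrix.of ![a - Pi.single u 1, b - Pi.single v 1]
  have h1 : ((1 : Matrix V V ℝ).updateRow u a).updateRow v b = 1 + P * Q := by
    ext c d
    rw [Matrix.add_apply, Matrix.mul_apply, Fin.sum_univ_two]
    by_cases hcv : c = v
    · subst hcv
      simp [P, Q, huv.symm, Matrix.one_apply, Pi.single_apply, eq_comm (a := d)]
    · rw [Matrix.updateRow_ne hcv]
      by_cases hcu : c = u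
      · subst hcu
        simp [P, Q, huv, Matrix.one_apply, Pi.single_apply, eq_comm (a := d)]
      · rw [Matrix.updateRow_ne hcu]
        simp [P, Q, hcu, hcv]
  have h2 : 1 + Q * P = !![a u, a v; b u, b v] := by
    ext i j
    rw [Matrix.add_apply, Matrix.mul_apply]
    fin_cases i <;> fin_cases j <;> simp [P, Q, Pi.single_apply, huv, huv.symm]
  rw [h1, Matrix.det_one_add_mul_comm, h2, Matrix.det_fin_two_of]

variable [Fintype V] [DecidableEq V] [Fintype E] [DecidableEq E]

/-- The inverse of the Laplacian grounded at `x` works after a correction of column `x`; a spanning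
tree makes the determinant nonzero. -/
theorem exists_isGreen {x : V} (hx : (rootedForests s t univ {x}).Nonempty) :
    ∃ h, IsGreen s t x h := by
  set M := groundedLaplacian s t univ {x} with hM
  have hdet : M.det = (rootedForests s t univ {x}).card := det_groundedLaplacian _ _
  have hdet0 : M.det ≠ 0 := by
    rw [hdet]
    exact_mod_cast hx.card_ne_zero
  have hMu : IsUnit M.det := isUnit_iff_ne_zero.2 hdet0
  set g := M⁻¹ with hg
  have hMg : M * g = 1 := Matrix.mul_nonsing_inv M hMu
  have hMx : M x = Pi.single x 1 := by
    ext b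
    simp [hM, groundedLaplacian, Pi.single_apply, eq_comm]
  have hgx : ∀ v, g x v = if x = v then 1 else 0 := fun v => by
    have := congrFun (congrFun hMg x) v
    rwa [Matrix.mul_apply', hMx, single_one_dotProduct, Matrix.one_apply] at this
  have hM1 : M.mulVec (fun _ => 1) = Pi.single x 1 := by
    ext a
    rw [Matrix.mulVec, dotProduct]
    by_cases ha : a = x
    · subst ha
      simp [hMx]
    · simp only [hM, groundedLaplacian, Matrix.of_apply, mem_singleton, ha, if_false, sum_mul]
      rw [sum_comm]
      simp_rw [mul_assoc, ← mul_sum, sum_incidence_mul]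
      simp [ha]
  have hg1 : ∀ v, g v x = 1 := fun v => by
    have h1 : g.mulVec (M.mulVec fun _ => 1) = fun _ => 1 := by
      rw [Matrix.mulVec_mulVec, hg, Matrix.nonsing_inv_mul M hMu, Matrix.one_mulVec]
    rw [hM1] at h1
    simpa using congrFun h1 v
  have hins : ∀ R v, (groundedLaplacian s t univ (insert v R)) =
    (groundedLaplacian s t univ R).updateRow v (Pi.single v 1) := fun R v =>
      groundedLaplacian_insert _ _ _
  have hmul : ∀ (v : V) (A : Matrix V V ℝ), A.updateRow v (Pi.single v 1) * g =
      (A * g).updateRow v (g.row v) := fun v A => by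
    rw [Matrix.updateRow_mul, Matrix.single_one_vecMul]
  have hdetg : M.det * g.det = 1 := by rw [← Matrix.det_mul, hMg, Matrix.det_one]
  -- Since `M` sends the constant 1 to δ_x, column `x` of `g` is constantly 1; subtracting it gives
  -- the Dirichlet condition in the second argument.
  refine ⟨fun u v => g u v - if v = x then 1 else 0, ?_, ?_, ?_, ?_, ?_⟩
  · intro v
    simp [hgx, eq_comm]
  · intro v
    simp [hg1]
  · intro f hf v
    by_cases hv : v = x
    · subst hv
      simp [hf, hg1]
    -- Only row `x` of `M` differs from the Laplacian, and there the factor `f x = 0` removes the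
    -- discrepancy.
    have h1 : ∀ a, f a * ∑ b, (∑ e, incidence s t e a * incidence s t e b) * g b v =
        if a = v then f a else 0 := fun a => by
      by_cases ha : a = x
      · subst ha
        simp [hf]
      · have := congrFun (congrFun hMg a) v
        simp only [Matrix.mul_apply, hM, groundedLaplacian, Matrix.of_apply, mem_singleton, ha,
          if_false, Matrix.one_apply] at this
        rw [this, mul_ite, mul_one, mul_zero]
    calc f v = ∑ a, f a * ∑ b, (∑ e, incidence s t e a * incidence s t e b) * g b v := by
          simp [h1]
      _ = ∑ e, (∑ a, incidence s t e a * f a) * ∑ b, incidence s t e b * g b v := by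
          simp_rw [sum_mul_sum, sum_mul, mul_sum]
          rw [sum_comm (s := univ (α := E))]
          refine sum_congr rfl fun a _ => ?_
          rw [sum_comm]
          exact sum_congr rfl fun e _ => sum_congr rfl fun b _ => by ring
      _ = _ := by simp [sum_incidence_mul, hv]
  · intro v hv
    have h1 := det_groundedLaplacian (s := s) (t := t) univ {v, x}
    -- Cramer's rule: the cofactor is the determinant with `v` grounded too.
    have h2 : M.det * g v v = (M.updateRow v (Pi.single v 1)).det := by
      rw [hg, Matrix.inv_def, Matrix.smul_apply, Matrix.adjugate_apply, smul_eq_mul, ← mul_assoc,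
        Ring.mul_inverse_cancel _ hMu, one_mul]
    rw [hins, ← hM] at h1
    simp only [hv, if_false, sub_zero]
    rw [← hdet, h2, h1, pair_comm]
  · intro u v hu hv huv
    have h1 := det_groundedLaplacian (s := s) (t := t) univ (insert v (insert u {x}))
    rw [hins, hins, ← hM] at h1
    -- Jacobi's identity for complementary minors: after multiplication by `g`, rows `u` and `v` are
    -- those of `g` and the others those of the identity.
    have h2 : (((M.updateRow u (Pi.single u 1)).updateRow v (Pi.single v 1)) * g).det =
        g u u * g v v - g u v * g v u := by
      rw [hmul, hmul, hMg, det_one_updateRow_updateRow huv]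
      rfl
    rw [Matrix.det_mul, h1] at h2
    have h4 : ({x, u, v} : Finset V) = insert v (insert u {x}) := by
      ext a
      simp only [mem_insert, mem_singleton]
      tauto
    simp only [hu, hv, if_false, sub_zero]
    rw [← hdet, h4]
    linear_combination (-M.det) * h2 +
      ((rootedForests s t univ (insert v (insert u {x}))).card : ℝ) * hdetg

end Green

end EdgeEnds

/-! ### Double counting of two-forests and cuts -/

namespace EdgeEnds

open Finset Relation

section TwoForests

variable {V E : Type*} (s t : E → V)

/-- `S` is a spanning forest with two components. -/
def IsTwoForest [Fintype V] [DecidableEq V] (S : Finset E) : Prop :=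
  ∃ u v, u ≠ v ∧ IsRootedForest s t S {u, v}

/-- The spanning forests with two components. -/
noncomputable def twoForestFinset [Fintype V] [DecidableEq V] [Fintype E] : Finset (Finset E) :=
  open Classical in univ.filter (IsTwoForest s t)

variable {s t} [Fintype V] [DecidableEq V]

theorem IsRootedForest.pair_of_joined {S : Finset E} {x y z : V}
    (h : IsRootedForest s t S {x, y}) (hxy : x ≠ y) (hz : Joined s t S z y) :
    z ≠ x ∧ IsRootedForest s t S {x, z} := by
  have hzx : z ≠ x := by
    rintro rfl
    exact hxy (h.eq_of_joined (by simp) (by simp) hz)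
  refine ⟨hzx, h.1.of_joined fun r hr => ?_, ?_⟩
  · rcases mem_insert.1 hr with rfl | hr
    · exact ⟨r, by simp, .refl⟩
    · rw [mem_singleton.1 hr]
      exact ⟨z, by simp, hz.symm⟩
  · rw [← h.2, card_pair hxy, card_pair hzx.symm]

theorem IsTwoForest.exists_root {S : Finset E} (h : IsTwoForest s t S) (x : V) :
    ∃ b, x ≠ b ∧ IsRootedForest s t S {x, b} := by
  obtain ⟨u, v, huv, h⟩ := h
  obtain ⟨r, hr, hj⟩ := h.1 x
  rcases mem_insert.1 hr with rfl | hr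
  · rw [pair_comm] at h
    obtain ⟨h1, h2⟩ := h.pair_of_joined huv.symm hj
    exact ⟨v, h1, pair_comm v x ▸ h2⟩
  · rw [mem_singleton.1 hr] at hj
    obtain ⟨h1, h2⟩ := h.pair_of_joined huv hj
    exact ⟨u, h1, pair_comm u x ▸ h2⟩

/-- The possible second roots form the component avoiding `x`, so counting roots measures that
component. -/
theorem IsRootedForest.pair_iff_joined {S : Finset E} {x b : V}
    (h : IsRootedForest s t S {x, b}) (hxb : x ≠ b) (v : V) :
    (v ≠ x ∧ IsRootedForest s t S {x, v}) ↔ Joined s t S v b := by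
  refine ⟨fun ⟨hv, hF⟩ => ?_, h.pair_of_joined hxb⟩
  obtain ⟨r, hr, hj⟩ := h.1 v
  rcases mem_insert.1 hr with rfl | hr
  · exact absurd (hF.eq_of_joined (by simp) (by simp) hj) hv
  · rwa [mem_singleton.1 hr] at hj

open Classical in
/-- A component of a forest has one more vertex than edges. -/
theorem IsRootedForest.card_component {S : Finset E} {x b : V}
    (h : IsRootedForest s t S {x, b}) (hxb : x ≠ b) :
    #{v | Joined s t S v b} = #{e ∈ S | Joined s t S (s e) b} + 1 := by
  obtain ⟨rk, p, hp⟩ := h.1.exists_parent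
  have hinj := parent_injective fun v => (hp v).2
  -- The edge count of a forest leaves no room for edges other than parent edges.
  have himg : univ.image p = S := by
    refine eq_of_subset_of_card_le (fun e he => ?_) ?_
    · obtain ⟨v, -, rfl⟩ := mem_image.1 he
      exact (hp v).1
    · rw [card_image_of_injective _ hinj, card_univ]
      have h1 := card_compl_subtype (V := V) {x, b}
      have h2 := h.2
      omega
  have hpj : ∀ v, Joined s t S (s (p v)) b ↔ Joined s t S v b := fun v => by
    obtain ⟨hS, w, hl, -⟩ := hp v
    rcases hl with ⟨h1, -⟩ | ⟨h1, h2⟩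
    · rw [h1]
    · have := Joined.single hS (link_self (s := s) (t := t) (p v))
      rw [h2] at this
      exact ⟨this.symm.trans, this.trans⟩
  -- In this component only `b` has no parent edge, which accounts for the extra vertex.
  have h1 : ({v | Joined s t S v b} : Finset V) = insert b
      (({v | Joined s t S v b} : Finset V).filter fun v => v ∉ ({x, b} : Finset V)) := by
    ext v
    simp only [mem_filter, mem_univ, true_and, mem_insert, mem_singleton]
    constructor
    · intro hv
      by_cases hvb : v = b
      · exact Or.inl hvb
      · exact Or.inr ⟨hv, by simp [hvb, (h.pair_of_joined hxb hv).1]⟩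
    · rintro (rfl | hv)
      exacts [.refl, hv.1]
  rw [h1, card_insert_of_notMem (by simp)]
  congr 1
  refine card_bij (fun v hv => p ⟨v, (mem_filter.1 hv).2⟩) ?_ ?_ ?_
  · intro v hv
    rw [mem_filter, hpj]
    exact ⟨(hp _).1, by simpa using (mem_filter.1 hv).1⟩
  · intro v hv w hw hvw
    exact congrArg Subtype.val (hinj hvw)
  · intro e he
    rw [mem_filter, ← himg] at he
    obtain ⟨he, hj⟩ := he
    obtain ⟨v, -, rfl⟩ := mem_image.1 he
    rw [himg, hpj] at hj
    exact ⟨v, by simpa using ⟨hj, by simpa using v.2⟩, rfl⟩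

variable [Fintype E]

theorem mem_twoForestFinset {S : Finset E} : S ∈ twoForestFinset s t ↔ IsTwoForest s t S := by
  simp [twoForestFinset]

omit [DecidableEq V] in
theorem mem_rootedForests_univ {S : Finset E} {R : Finset V} :
    S ∈ rootedForests s t univ R ↔ IsRootedForest s t S R := by
  simp [mem_rootedForests]

open Classical in
theorem filter_twoForestFinset {u v : V} (huv : u ≠ v) :
    (twoForestFinset s t).filter (fun S => IsRootedForest s t S {u, v}) =
      rootedForests s t univ {u, v} := by
  ext S
  rw [mem_filter, mem_twoForestFinset, mem_rootedForests_univ]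
  exact ⟨And.right, fun h => ⟨⟨u, v, huv, h⟩, h⟩⟩

variable [DecidableEq E]

open Classical in
/-- Counting two-forests by the vertices and edges separated from `x`. -/
theorem card_twoForestFinset_add (hst : ∀ e, s e ≠ t e) (x : V) :
    #(twoForestFinset s t) +
        ∑ e with s e ≠ x ∧ t e ≠ x, #(rootedForests s t univ {x, s e, t e}) =
      ∑ v ∈ univ.erase x, #(rootedForests s t univ {x, v}) := by
  have hV : ∑ v ∈ univ.erase x, #(rootedForests s t univ {x, v}) =
      ∑ S ∈ twoForestFinset s t, #{v ∈ univ.erase x | IsRootedForest s t S {x, v}} := by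
    refine Eq.trans ?_ (sum_card_bipartiteAbove_eq_sum_card_bipartiteBelow
      (fun v S => IsRootedForest s t S {x, v}))
    refine sum_congr rfl fun v hv => ?_
    rw [bipartiteAbove, filter_twoForestFinset (ne_of_mem_erase hv).symm]
  have hE : ∑ e with s e ≠ x ∧ t e ≠ x, #(rootedForests s t univ {x, s e, t e}) =
      ∑ S ∈ twoForestFinset s t,
        #{e ∈ univ.filter (fun e => s e ≠ x ∧ t e ≠ x) |
          IsRootedForest s t S {x, s e} ∧ e ∈ S} := by
    refine Eq.trans ?_ (sum_card_bipartiteAbove_eq_sum_card_bipartiteBelow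
      (fun e S => IsRootedForest s t S {x, s e} ∧ e ∈ S))
    refine sum_congr rfl fun e he => ?_
    -- Removing `e` makes its other end a third root, so forests rooted at `x` and both ends of `e`
    -- count the two-forests with `e` in the component avoiding `x`.
    simp only [mem_filter, mem_univ, true_and] at he
    rw [bipartiteAbove, ← filter_filter, filter_twoForestFinset he.1.symm,
      card_filter_mem_rootedForests (mem_univ e) (u := s e) (v := t e) (by simp)
        (by simp [he.2, (hst e).symm]) (link_self e)]
    congr 2
    ext a
    simp only [mem_insert, mem_singleton]
    tauto
  -- It remains to check each two-forest: 1 plus the edges of the component avoiding `x` equals its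
  -- vertices.
  rw [hV, hE, card_eq_sum_ones, ← sum_add_distrib]
  refine sum_congr rfl fun S hS => ?_
  obtain ⟨b, hxb, hF⟩ := (mem_twoForestFinset.1 hS).exists_root x
  have h1 : {v ∈ univ.erase x | IsRootedForest s t S {x, v}} =
      ({v | Joined s t S v b} : Finset V) := by
    ext v
    simp [← hF.pair_iff_joined hxb v]
  have h2 : {e ∈ univ.filter (fun e => s e ≠ x ∧ t e ≠ x) |
      IsRootedForest s t S {x, s e} ∧ e ∈ S} = {e ∈ S | Joined s t S (s e) b} := by
    ext e
    simp only [mem_filter, mem_univ, true_and]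
    constructor
    · rintro ⟨⟨h1, -⟩, h2, h3⟩
      exact ⟨h3, (hF.pair_iff_joined hxb _).1 ⟨h1, h2⟩⟩
    · rintro ⟨h1, h2⟩
      obtain ⟨h3, h4⟩ := (hF.pair_iff_joined hxb _).2 h2
      have h5 := (Joined.single h1 (link_self (s := s) (t := t) e)).symm.trans h2
      exact ⟨⟨h3, (hF.pair_of_joined hxb h5).1⟩, h4, h1⟩
  rw [h1, h2, hF.card_component hxb, add_comm]

open Classical in
/-- Pairs of a two-forest and an edge of its cut correspond to pairs of a spanning tree and
one of its edges. -/
theorem sum_card_cut (hst : ∀ e, s e ≠ t e) (x : V) :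
    ∑ S ∈ twoForestFinset s t, #{e | ¬ Joined s t S (s e) (t e)} =
      (Fintype.card V - 1) * #(rootedForests s t univ {x}) := by
  -- A spanning tree may be rooted anywhere; below, each edge `e` uses the root `s e`.
  have h1 : ∀ y, rootedForests s t univ {y} = rootedForests s t univ {x} := fun y => by
    suffices ∀ (a b : V) (S : Finset E), IsRootedForest s t S {a} → IsRootedForest s t S {b} by
      ext S
      rw [mem_rootedForests_univ, mem_rootedForests_univ]
      exact ⟨this _ _ S, this _ _ S⟩
    intro a b S h
    have h' : ∀ v, Joined s t S v a := fun v => by simpa using h.1 v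
    exact ⟨fun v => ⟨b, by simp, (h' v).trans (h' b).symm⟩, by simpa using h.2⟩
  have h2 : ∀ e, #((twoForestFinset s t).filter fun S => ¬ Joined s t S (s e) (t e)) =
      #((rootedForests s t univ {x}).filter fun T => e ∈ T) := fun e => by
    rw [← h1 (s e), card_filter_mem_rootedForests (mem_univ e) (u := s e) (v := t e) (by simp)
        (by simp [(hst e).symm]) (link_self e), ← filter_twoForestFinset (hst e).symm]
    congr 1
    refine filter_congr fun S hS => ?_
    obtain ⟨b, hb, hF⟩ := (mem_twoForestFinset.1 hS).exists_root (s e)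
    rw [pair_comm]
    constructor
    · intro h
      obtain ⟨r, hr, hj⟩ := hF.1 (t e)
      rcases mem_insert.1 hr with rfl | hr
      · exact absurd hj.symm h
      · rw [mem_singleton.1 hr] at hj
        exact (hF.pair_of_joined hb hj).2
    · intro h hj
      exact hst e (h.eq_of_joined (by simp) (by simp) hj)
  calc ∑ S ∈ twoForestFinset s t, #{e | ¬ Joined s t S (s e) (t e)}
      = ∑ e, #((twoForestFinset s t).filter fun S => ¬ Joined s t S (s e) (t e)) :=
        sum_card_bipartiteAbove_eq_sum_card_bipartiteBelow
          (fun S e => ¬ Joined s t S (s e) (t e))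
    _ = ∑ e, #((rootedForests s t univ {x}).filter fun T => e ∈ T) :=
        sum_congr rfl fun e _ => h2 e
    _ = ∑ T ∈ rootedForests s t univ {x}, #(univ.filter fun e => e ∈ T) :=
        sum_card_bipartiteAbove_eq_sum_card_bipartiteBelow (fun e T => e ∈ T)
    _ = ∑ T ∈ rootedForests s t univ {x}, (Fintype.card V - 1) := by
        refine sum_congr rfl fun T hT => ?_
        have := (mem_rootedForests_univ.1 hT).2
        rw [card_singleton] at this
        rw [filter_univ_mem]
        omega
    _ = _ := by rw [sum_const, smul_eq_mul, mul_comm]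

end TwoForests

end EdgeEnds

/-! ### Effective resistances and the main inequality -/

namespace EdgeEnds

open Finset Relation

section Bound

variable {V E : Type*} {s t : E → V} [Fintype V] [DecidableEq V] [Fintype E]

/-- Reproducing `h · v` at `u` and `h · u` at `v` gives the same sum over edges. -/
theorem IsGreen.symm {x : V} {h : V → V → ℝ} (hh : IsGreen s t x h) (u v : V) : h u v = h v u := by
  rw [hh.reproducing (fun w => h w v) (hh.left_zero v) u,
    hh.reproducing (fun w => h w u) (hh.left_zero u) v]
  exact sum_congr rfl fun e _ => mul_comm _ _

/-- A weighted Foster identity: reproduce δ_w at `w`, multiply by `φ w`, and sum over `w`. It is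
used for `φ = 1` and for the diagonal of `h`. -/
theorem IsGreen.sum_trace {x : V} {h : V → V → ℝ} (hh : IsGreen s t x h) (φ : V → ℝ) :
    ∑ e, (φ (s e) * (h (s e) (s e) - h (s e) (t e)) + φ (t e) * (h (t e) (t e) - h (s e) (t e))) =
      ∑ w ∈ univ.erase x, φ w := by
  have h1 : ∀ w, ∑ e, incidence s t e w * (φ w * (h (s e) w - h (t e) w)) =
      if w = x then 0 else φ w := fun w => by
    split_ifs with hw
    · subst hw
      simp [hh.right_zero]
    · have h2 := hh.reproducing (Pi.single w 1) (by simp [Ne.symm hw]) w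
      rw [Pi.single_eq_same] at h2
      have h3 : ∀ e, incidence s t e w =
          (Pi.single w 1 : V → ℝ) (s e) - (Pi.single w 1 : V → ℝ) (t e) := fun e => by
        simp [incidence, Pi.single_apply]
      simp_rw [h3, mul_left_comm _ (φ w)]
      rw [← mul_sum, ← h2, mul_one]
  calc _ = ∑ e, ∑ w, incidence s t e w * (φ w * (h (s e) w - h (t e) w)) := by
        refine sum_congr rfl fun e _ => ?_
        rw [sum_incidence_mul, hh.symm (t e) (s e)]
        ring
    _ = ∑ w, if w = x then 0 else φ w := by
        rw [sum_comm]
        exact sum_congr rfl fun w _ => h1 w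
    _ = _ := by
        rw [← add_sum_erase univ _ (mem_univ x), if_pos rfl, zero_add]
        exact sum_congr rfl fun w hw => if_neg (ne_of_mem_erase hw)

variable [DecidableEq E]

/-- This is `card_twoForestFinset_add` in terms of `h`. The sum may run over all edges because the
minor of an edge at `x` vanishes. -/
theorem card_twoForestFinset_eq (hst : ∀ e, s e ≠ t e) {x : V} {h : V → V → ℝ}
    (hh : IsGreen s t x h) :
    (#(twoForestFinset s t) : ℝ) = #(rootedForests s t univ {x}) *
      (∑ v ∈ univ.erase x, h v v - ∑ e, (h (s e) (s e) * h (t e) (t e) - h (s e) (t e) ^ 2)) := by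
  have h1 : (#(twoForestFinset s t) : ℝ) +
      ∑ e with s e ≠ x ∧ t e ≠ x, (#(rootedForests s t univ {x, s e, t e}) : ℝ) =
      ∑ v ∈ univ.erase x, (#(rootedForests s t univ {x, v}) : ℝ) := by
    exact_mod_cast card_twoForestFinset_add hst x
  have h2 : ∑ v ∈ univ.erase x, (#(rootedForests s t univ {x, v}) : ℝ) =
      #(rootedForests s t univ {x}) * ∑ v ∈ univ.erase x, h v v := by
    rw [mul_sum]
    exact sum_congr rfl fun v hv => (hh.diag v (ne_of_mem_erase hv)).symm
  have h3 : ∑ e with s e ≠ x ∧ t e ≠ x, (#(rootedForests s t univ {x, s e, t e}) : ℝ) =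
      #(rootedForests s t univ {x}) *
        ∑ e, (h (s e) (s e) * h (t e) (t e) - h (s e) (t e) ^ 2) := by
    rw [mul_sum, sum_filter]
    refine sum_congr rfl fun e _ => ?_
    split_ifs with he
    · rw [← hh.minor _ _ he.1 he.2 (hst e), hh.symm (t e) (s e), sq]
    · by_cases h4 : s e = x
      · simp [h4, hh.left_zero]
      · have h5 : t e = x := by tauto
        simp [h5, hh.left_zero, hh.right_zero]
  rw [mul_sub, ← h2, ← h3, ← h1, add_sub_cancel_right]

/-- The number of two-forests compared to the number of spanning trees. -/
theorem card_sub_one_sq_mul_le (hst : ∀ e, s e ≠ t e) {x : V}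
    (hx : (rootedForests s t univ {x}).Nonempty) :
    ((Fintype.card V : ℝ) - 1) ^ 2 * #(rootedForests s t univ {x}) ≤
      4 * Fintype.card E * #(twoForestFinset s t) := by
  obtain ⟨h, hh⟩ := exists_isGreen hx
  set r : E → ℝ := fun e => h (s e) (s e) + h (t e) (t e) - 2 * h (s e) (t e) with hr
  have hsum : ∑ e, r e = (Fintype.card V : ℝ) - 1 := by
    have h1 := hh.sum_trace fun _ => 1
    rw [sum_const, card_erase_of_mem (mem_univ x), card_univ, nsmul_eq_mul, mul_one,
      Nat.cast_sub (Fintype.card_pos_iff.2 ⟨x⟩), Nat.cast_one] at h1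
    rw [← h1]
    exact sum_congr rfl fun e _ => by simp only [hr]; ring
  have hsq : ((Fintype.card V : ℝ) - 1) ^ 2 ≤ Fintype.card E * ∑ e, r e ^ 2 := by
    rw [← hsum]
    exact sq_sum_le_card_mul_sum_sq
  have hle : ∑ e, r e ^ 2 ≤ 4 * (∑ v ∈ univ.erase x, h v v -
      ∑ e, (h (s e) (s e) * h (t e) (t e) - h (s e) (t e) ^ 2)) := by
    rw [← hh.sum_trace fun v => h v v, ← sum_sub_distrib, mul_sum]
    -- Edge by edge, the right side exceeds the left by three times the squared difference of the
    -- diagonal values at the ends.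
    refine sum_le_sum fun e _ => ?_
    simp only [hr]
    nlinarith [sq_nonneg (h (s e) (s e) - h (t e) (t e))]
  rw [card_twoForestFinset_eq hst hh]
  calc ((Fintype.card V : ℝ) - 1) ^ 2 * #(rootedForests s t univ {x})
      ≤ (Fintype.card E * ∑ e, r e ^ 2) * #(rootedForests s t univ {x}) := by gcongr
    _ ≤ (Fintype.card E * (4 * (∑ v ∈ univ.erase x, h v v -
          ∑ e, (h (s e) (s e) * h (t e) (t e) - h (s e) (t e) ^ 2)))) *
          #(rootedForests s t univ {x}) := by gcongr
    _ = _ := by ring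

end Bound

end EdgeEnds

/-! ### Translation to `Graph` -/

namespace TwoForest

open Finset Relation EdgeEnds

variable {α β : Type*} {G : Graph α β} {s t : G.edgeSet → G.vertexSet}

/-- The spanning subgraph of `G` with edge set `S`. -/
def spanningSubgraph (G : Graph α β) (S : Finset G.edgeSet) : Graph α β :=
  G.restrict (Subtype.val '' (S : Set G.edgeSet))

theorem spanningSubgraph_isSpanningSubgraph (S : Finset G.edgeSet) :
    (spanningSubgraph G S).IsSpanningSubgraph G where
  le := Graph.restrict_le
  vertexSet_eq := rfl

theorem edgeSet_spanningSubgraph (S : Finset G.edgeSet) :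
    (spanningSubgraph G S).edgeSet = Subtype.val '' (S : Set G.edgeSet) := by
  rw [spanningSubgraph, Graph.edgeSet_restrict, Set.inter_eq_right]
  rintro _ ⟨e, -, rfl⟩
  exact e.2

theorem spanningSubgraph_injective : Function.Injective (spanningSubgraph G) := fun S T h => by
  have := congrArg Graph.edgeSet h
  rw [edgeSet_spanningSubgraph, edgeSet_spanningSubgraph] at this
  exact Finset.coe_injective (Subtype.val_injective.image_injective this)

theorem link_iff_isLink (hst : ∀ e : G.edgeSet, G.IsLink e (s e) (t e)) {e : G.edgeSet}
    {a b : G.vertexSet} :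
    Link s t e a b ↔ G.IsLink e a b := by
  rw [(hst e).isLink_iff, Link, Subtype.ext_iff, Subtype.ext_iff, Subtype.ext_iff, Subtype.ext_iff]

theorem isLink_spanningSubgraph (hst : ∀ e : G.edgeSet, G.IsLink e (s e) (t e))
    {S : Finset G.edgeSet}
    {e : G.edgeSet} {a b : G.vertexSet} :
    (spanningSubgraph G S).IsLink e a b ↔ e ∈ S ∧ Link s t e a b := by
  rw [link_iff_isLink hst]
  change e.1 ∈ Subtype.val '' (S : Set G.edgeSet) ∧ G.IsLink e a b ↔ _
  simp

theorem reachable_spanningSubgraph (hst : ∀ e : G.edgeSet, G.IsLink e (s e) (t e))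
    {S : Finset G.edgeSet}
    {a b : G.vertexSet} : Reachable (spanningSubgraph G S) a b ↔ Joined s t S a b := by
  constructor
  · suffices ∀ c, Reachable (spanningSubgraph G S) a c → ∃ hc, Joined s t S a ⟨c, hc⟩ from
      fun h => (this b h).2
    intro c h
    induction h with
    | refl => exact ⟨a.2, .refl⟩
    | @tail c d _ hl ih =>
      obtain ⟨e, hl⟩ := hl
      obtain ⟨hc, hj⟩ := ih
      have hd : d ∈ G.vertexSet := hl.right_mem
      have he : e ∈ (spanningSubgraph G S).edgeSet := hl.edge_mem
      rw [edgeSet_spanningSubgraph] at he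
      obtain ⟨e, -, rfl⟩ := he
      obtain ⟨he, hl⟩ := (isLink_spanningSubgraph hst (a := ⟨c, hc⟩) (b := ⟨d, hd⟩)).1 hl
      exact ⟨hd, hj.trans (Joined.single he hl)⟩
  · intro h
    induction h with
    | refl => exact .refl
    | tail _ hl ih =>
      obtain ⟨e, he, hl⟩ := hl
      exact ih.tail ⟨e, (isLink_spanningSubgraph hst).2 ⟨he, hl⟩⟩

/-- A simple path avoiding `e` between its ends is closed up by `e`. -/
theorem hasCycle_of_joined_erase [DecidableEq G.edgeSet] [G.Loopless]
    (hst : ∀ e : G.edgeSet, G.IsLink e (s e) (t e)) {S : Finset G.edgeSet} {e : G.edgeSet} (he : e ∈ S)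
    (hj : Joined s t (S.erase e) (s e) (t e)) : HasCycle (spanningSubgraph G S) := by
  classical
  -- Forgetting multiplicities gives access to simple paths; `f` later picks an edge of `G` for each
  -- step.
  let A : SimpleGraph G.vertexSet :=
    { Adj := fun a b => ∃ e' ∈ S.erase e, Link s t e' a b
      symm := ⟨fun a b ⟨e', he', hl⟩ => ⟨e', he', hl.symm⟩⟩
      loopless := ⟨fun a ⟨e', _, hl⟩ => ((link_iff_isLink hst).1 hl).ne rfl⟩ }
  obtain ⟨p, hp⟩ := ((SimpleGraph.reachable_iff_reflTransGen (G := A) _ _).2 hj).exists_isPath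
  have hinj := hp.getVert_injOn
  choose f hf hfl using fun i : {i // i < p.length} => p.adj_getVert_succ i.2
  refine ⟨p.length, fun i => (p.getVert i).1,
    fun i => if hi : i.1 < p.length then (f ⟨i.1, hi⟩).1 else e.1, ?_, ?_, ?_⟩
  · intro i j hij
    exact Fin.ext (hinj (Nat.lt_succ_iff.1 i.2) (Nat.lt_succ_iff.1 j.2) (Subtype.ext hij))
  · have hne : ∀ i, (f i).1 ≠ e.1 := fun i h => (mem_erase.1 (hf i)).1 (Subtype.ext h)
    intro i j hij
    by_cases hi : i.1 < p.length <;> by_cases hj : j.1 < p.length <;>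
      simp only [hi, hj, dif_pos, dif_neg, not_false_eq_true] at hij
    · have h1 := (link_iff_isLink hst).1 (hfl ⟨i.1, hi⟩)
      have h2 := (link_iff_isLink hst).1 (hfl ⟨j.1, hj⟩)
      rw [hij] at h1
      have hinj' : ∀ {a b : ℕ}, a ≤ p.length → b ≤ p.length →
          (p.getVert a).1 = (p.getVert b).1 → a = b := fun ha hb h => hinj ha hb (Subtype.ext h)
      -- A repeated edge joins the same two vertices; the reversed case would need i = j + 1 and i +
      -- 1 = j.
      rcases h1.eq_and_eq_or_eq_and_eq h2 with ⟨h, -⟩ | ⟨h, h'⟩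
      · exact Fin.ext (hinj' hi.le hj.le h)
      · have h3 := hinj' hi.le hj h
        have h4 := hinj' hi hj.le h'
        omega
    · exact absurd hij (hne _)
    · exact absurd hij.symm (hne _)
    · exact Fin.ext (by omega)
  · intro i
    by_cases hi : i.1 < p.length
    · have h1 : (i + 1).1 = i.1 + 1 := Fin.val_add_one_of_lt (Fin.lt_def.2 hi)
      simp only [hi, dif_pos, h1]
      exact (isLink_spanningSubgraph hst).2 ⟨mem_of_mem_erase (hf _), hfl ⟨i.1, hi⟩⟩
    · have h1 : i = Fin.last _ := Fin.ext (by simp only [Fin.val_last]; omega)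
      subst h1
      simp only [lt_irrefl, dif_neg, not_false_eq_true, Fin.last_add_one, Fin.val_last,
        Fin.val_zero, SimpleGraph.Walk.getVert_length, SimpleGraph.Walk.getVert_zero]
      exact (isLink_spanningSubgraph hst).2 ⟨he, (link_self e).symm⟩

/-- The rest of the cycle joins the ends of its edge number 0; for a loop this path is trivial. -/
theorem exists_joined_erase_of_hasCycle [DecidableEq G.edgeSet]
    (hst : ∀ e : G.edgeSet, G.IsLink e (s e) (t e)) {S : Finset G.edgeSet}
    (h : HasCycle (spanningSubgraph G S)) : ∃ e ∈ S, Joined s t (S.erase e) (s e) (t e) := by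
  obtain ⟨n, v, f, -, hf, hl⟩ := h
  have hv : ∀ i, v i ∈ G.vertexSet := fun i => (hl i).left_mem
  have hfS : ∀ i, ∃ e ∈ S, e.1 = f i := fun i => by
    have := (hl i).edge_mem
    rwa [edgeSet_spanningSubgraph] at this
  choose f' hf' hff' using hfS
  have hlink : ∀ i, Link s t (f' i) ⟨v i, hv i⟩ ⟨v (i + 1), hv (i + 1)⟩ := fun i =>
    ((isLink_spanningSubgraph hst).1 ((hff' i).symm ▸ hl i)).2
  have hc : ∀ k : ℕ, Fin.ofNat (n + 1) k + 1 = Fin.ofNat (n + 1) (k + 1) := fun k =>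
    Fin.ext (by simp [Fin.val_add])
  have hj : ∀ k : ℕ, k ≤ n → Joined s t (S.erase (f' 0)) ⟨v 1, hv 1⟩
      ⟨v (Fin.ofNat (n + 1) (k + 1)), hv (Fin.ofNat (n + 1) (k + 1))⟩ := by
    intro k hk
    induction k with
    | zero => exact ReflTransGen.refl
    | succ k ih =>
      refine (ih (by omega)).trans (Joined.single (e := f' (Fin.ofNat (n + 1) (k + 1))) ?_ ?_)
      · refine mem_erase.2 ⟨fun h => ?_, hf' _⟩
        have h1 := congrArg Subtype.val h
        rw [hff', hff'] at h1
        have h2 := congrArg Fin.val (hf h1)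
        rw [Fin.val_ofNat, Nat.mod_eq_of_lt (by omega), Fin.val_zero] at h2
        omega
      · simpa only [hc] using hlink (Fin.ofNat (n + 1) (k + 1))
  refine ⟨f' 0, hf' 0, ?_⟩
  have h1 := hj n le_rfl
  have h0 : Fin.ofNat (n + 1) (n + 1) = 0 := Fin.ext (by simp)
  simp only [h0] at h1
  have h2 := hlink 0
  simp only [zero_add] at h2
  rcases h2 with ⟨h2, h3⟩ | ⟨h2, h3⟩
  · rw [h2, h3]
    exact h1.symm
  · rw [h2, h3]
    exact h1

theorem component_eq_iff (hst : ∀ e : G.edgeSet, G.IsLink e (s e) (t e)) {S : Finset G.edgeSet}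
    {a b : G.vertexSet} :
    {y | Reachable (spanningSubgraph G S) a y} = {y | Reachable (spanningSubgraph G S) b y} ↔
      Joined s t S a b := by
  constructor
  · intro h
    have : b.1 ∈ {y | Reachable (spanningSubgraph G S) b y} := ReflTransGen.refl
    rw [← h] at this
    exact (reachable_spanningSubgraph hst).1 this
  · intro h
    ext y
    exact ⟨((reachable_spanningSubgraph hst).2 h.symm).trans,
      ((reachable_spanningSubgraph hst).2 h).trans⟩

variable [Fintype G.vertexSet] [DecidableEq G.vertexSet]

/-- Both notions of forest say that every edge is a bridge; one representative of each component
serves as a root. -/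
theorem spanningSubgraph_mem_twoForests [G.Loopless] (hst : ∀ e : G.edgeSet, G.IsLink e (s e) (t e))
    {S : Finset G.edgeSet} :
    spanningSubgraph G S ∈ twoForests G ↔ IsTwoForest s t S := by
  classical
  constructor
  · rintro ⟨-, hc, h2⟩
    obtain ⟨A, B, hAB, h⟩ := Set.ncard_eq_two.1 h2
    obtain ⟨u, hu, rfl⟩ : A ∈ components (spanningSubgraph G S) := by simp [h]
    obtain ⟨v, hv, rfl⟩ : B ∈ components (spanningSubgraph G S) := by simp [h]
    have huv : ¬ Joined s t S ⟨u, hu⟩ ⟨v, hv⟩ := fun hj => hAB ((component_eq_iff hst).2 hj)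
    refine ⟨⟨u, hu⟩, ⟨v, hv⟩, fun h => huv (h ▸ .refl), isRootedForest_of_bridges ?_ ?_ ?_⟩
    · intro w
      have hw : {y | Reachable (spanningSubgraph G S) w y} ∈ components (spanningSubgraph G S) :=
        ⟨w, w.2, rfl⟩
      rw [h] at hw
      rcases hw with hw | hw
      · exact ⟨_, by simp, (component_eq_iff hst (b := ⟨u, hu⟩)).1 hw⟩
      · exact ⟨_, by simp, (component_eq_iff hst (b := ⟨v, hv⟩)).1 hw⟩
    · intro a ha b hb hj
      simp only [mem_insert, mem_singleton] at ha hb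
      rcases ha with rfl | rfl <;> rcases hb with rfl | rfl
      exacts [rfl, absurd hj huv, absurd hj.symm huv, rfl]
    · exact fun e he hj => hc (hasCycle_of_joined_erase hst he hj)
  · rintro ⟨u, v, huv, hF⟩
    refine ⟨spanningSubgraph_isSpanningSubgraph S, fun hc => ?_, ?_⟩
    · obtain ⟨e, he, hj⟩ := exists_joined_erase_of_hasCycle hst hc
      exact hF.not_joined_erase he hj
    · refine Set.ncard_eq_two.2 ⟨_, _, fun h => huv (hF.eq_of_joined (by simp) (by simp)
        ((component_eq_iff hst (a := u) (b := v)).1 h)), ?_⟩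
      ext C
      constructor
      · rintro ⟨w, hw, rfl⟩
        obtain ⟨r, hr, hj⟩ := hF.1 ⟨w, hw⟩
        have := (component_eq_iff hst).2 hj
        rcases mem_insert.1 hr with rfl | hr
        · exact Or.inl this
        · rw [mem_singleton.1 hr] at this
          exact Or.inr this
      · rintro (rfl | rfl)
        exacts [⟨u, u.2, rfl⟩, ⟨v, v.2, rfl⟩]

omit [Fintype G.vertexSet] [DecidableEq G.vertexSet] in
theorem cutSet_spanningSubgraph (hst : ∀ e : G.edgeSet, G.IsLink e (s e) (t e))
    (S : Finset G.edgeSet) :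
    cutSet G (spanningSubgraph G S) = Subtype.val '' {e | ¬ Joined s t S (s e) (t e)} := by
  ext e
  constructor
  · rintro ⟨A, ⟨a, ha, rfl⟩, B, ⟨b, hb, rfl⟩, hAB, u, hu, v, hv, hl⟩
    refine ⟨⟨e, hl.edge_mem⟩, fun hj => hAB ?_, rfl⟩
    have huv : Joined s t S ⟨u, hl.left_mem⟩ ⟨v, hl.right_mem⟩ := by
      rcases (link_iff_isLink hst (e := ⟨e, hl.edge_mem⟩) (a := ⟨u, hl.left_mem⟩)
        (b := ⟨v, hl.right_mem⟩)).2 hl with ⟨h1, h2⟩ | ⟨h1, h2⟩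
      · rwa [← h1, ← h2]
      · rw [← h1, ← h2]
        exact hj.symm
    have hau := (reachable_spanningSubgraph hst (a := ⟨a, ha⟩) (b := ⟨u, hl.left_mem⟩)).1 hu
    have hbv := (reachable_spanningSubgraph hst (a := ⟨b, hb⟩) (b := ⟨v, hl.right_mem⟩)).1 hv
    exact (component_eq_iff hst).2 ((hau.trans huv).trans hbv.symm)
  · rintro ⟨e, he, rfl⟩
    exact ⟨_, ⟨s e, (s e).2, rfl⟩, _, ⟨t e, (t e).2, rfl⟩,
      fun h => he ((component_eq_iff hst).1 h), _, .refl, _, .refl, hst e⟩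

variable [Fintype G.edgeSet]

theorem twoForests_eq_image [G.Loopless] (hst : ∀ e : G.edgeSet, G.IsLink e (s e) (t e)) :
    twoForests G = spanningSubgraph G '' (twoForestFinset s t : Set (Finset G.edgeSet)) := by
  classical
  ext F
  constructor
  · intro hF
    have h : spanningSubgraph G (univ.filter fun e => e.1 ∈ F.edgeSet) = F := by
      refine (Graph.Compatible.of_le_le Graph.restrict_le hF.1.le).ext hF.1.vertexSet_eq.symm ?_
      rw [edgeSet_spanningSubgraph]
      ext e
      constructor
      · rintro ⟨e, he, rfl⟩
        simpa using he
      · intro he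
        exact ⟨⟨e, hF.1.le.edgeSet_mono he⟩, by simpa using he, rfl⟩
    refine ⟨_, ?_, h⟩
    rw [mem_coe, mem_twoForestFinset, ← spanningSubgraph_mem_twoForests hst, h]
    exact hF
  · rintro ⟨S, hS, rfl⟩
    exact (spanningSubgraph_mem_twoForests hst).2 (mem_twoForestFinset.1 hS)

open Classical in
theorem expectedCutSize_eq [G.Loopless] (hst : ∀ e : G.edgeSet, G.IsLink e (s e) (t e)) :
    expectedCutSize G = (∑ S ∈ twoForestFinset s t, #{e | ¬ Joined s t S (s e) (t e)} : ℕ) /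
      (#(twoForestFinset s t) : ℝ) := by
  rw [expectedCutSize, twoForests_eq_image hst, finsum_mem_image spanningSubgraph_injective.injOn,
    finsum_mem_coe_finset, Set.ncard_image_of_injective _ spanningSubgraph_injective,
    Set.ncard_coe_finset, Nat.cast_sum]
  congr 1
  refine sum_congr rfl fun S _ => ?_
  rw [cutSet_spanningSubgraph hst, Set.ncard_image_of_injective _ Subtype.val_injective,
    ← Set.ncard_coe_finset]
  simp

omit [Fintype G.vertexSet] in
theorem degree_eq (hst : ∀ e : G.edgeSet, G.IsLink e (s e) (t e)) (v : G.vertexSet) :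
    degree G v = #{e | v ∈ ({s e, t e} : Finset G.vertexSet)} := by
  rw [← Set.ncard_coe_finset, ← Set.ncard_image_of_injective _ Subtype.val_injective, degree]
  congr 1
  ext e
  simp only [Set.mem_image, mem_coe, mem_filter, mem_univ, true_and, mem_insert, mem_singleton,
    Set.mem_ofPred_eq]
  constructor
  · intro h
    refine ⟨⟨e, h.edge_mem⟩, ?_, rfl⟩
    exact (h.eq_or_eq_of_isLink (hst ⟨e, h.edge_mem⟩)).imp Subtype.ext Subtype.ext
  · rintro ⟨e, rfl | rfl, rfl⟩
    exacts [(hst e).inc_left, (hst e).inc_right]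

theorem avgDegree_eq [G.Loopless] (hst : ∀ e : G.edgeSet, G.IsLink e (s e) (t e)) :
    avgDegree G = 2 * (Fintype.card G.edgeSet : ℝ) / Fintype.card G.vertexSet := by
  rw [avgDegree, ← Nat.card_coe_set_eq, Nat.card_eq_fintype_card,
    ← finsum_set_coe_eq_finsum_mem (f := fun v => (degree G v : ℝ)), finsum_eq_sum_of_fintype,
    ← Nat.cast_sum]
  congr 1
  have h : ∑ v : G.vertexSet, degree G v = 2 * Fintype.card G.edgeSet := by
    calc ∑ v : G.vertexSet, degree G v
        = ∑ v : G.vertexSet, #{e | v ∈ ({s e, t e} : Finset G.vertexSet)} :=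
          sum_congr rfl fun v _ => degree_eq hst v
      _ = ∑ e, #{v | v ∈ ({s e, t e} : Finset G.vertexSet)} :=
          sum_card_bipartiteAbove_eq_sum_card_bipartiteBelow
            (fun v e => v ∈ ({s e, t e} : Finset G.vertexSet))
      _ = ∑ e : G.edgeSet, 2 := by
          refine sum_congr rfl fun e _ => ?_
          rw [filter_univ_mem, card_pair fun h => (hst e).ne (congrArg Subtype.val h)]
      _ = _ := by rw [sum_const, card_univ, smul_eq_mul, mul_comm]
  exact_mod_cast h

end TwoForest

/-! ### Conclusion -/

theorem theoremB {α β : Type*} (G : Graph α β) [G.Loopless]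
    (hV : G.vertexSet.Finite) (hE : G.edgeSet.Finite)
    (hconn : TwoForest.Connected G) (hcard : 2 ≤ G.vertexSet.ncard) :
    (TwoForest.twoForests G).Nonempty ∧
    TwoForest.avgDegree G = 2 * (G.edgeSet.ncard : ℝ) / (G.vertexSet.ncard : ℝ) ∧
    TwoForest.expectedCutSize G ≤
      2 * TwoForest.avgDegree G * (1 + 1 / ((G.vertexSet.ncard : ℝ) - 1)) := by
  classical
  have := hV.fintype
  have := hE.fintype
  have hends : ∀ e : G.edgeSet, ∃ a b : G.vertexSet, G.IsLink e a b := fun e => by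
    obtain ⟨a, b, h⟩ := G.exists_isLink_of_mem_edgeSet e.2
    exact ⟨⟨a, h.left_mem⟩, ⟨b, h.right_mem⟩, h⟩
  choose s t hst using hends
  have hne : ∀ e, s e ≠ t e := fun e h => (hst e).ne (congrArg Subtype.val h)
  have huniv : TwoForest.spanningSubgraph G Finset.univ = G := by
    rw [TwoForest.spanningSubgraph, Graph.restrict_eq_self_iff]
    simp
  have hjoin : ∀ a b, EdgeEnds.Joined s t Finset.univ a b := fun a b => by
    rw [← TwoForest.reachable_spanningSubgraph hst, huniv]
    exact hconn.2 _ a.2 _ b.2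
  rw [← Nat.card_coe_set_eq, ← Nat.card_coe_set_eq, Nat.card_eq_fintype_card,
    Nat.card_eq_fintype_card] at *
  obtain ⟨x, y, hxy⟩ := Fintype.exists_pair_of_one_lt_card hcard
  have hspan : ∀ R : Finset G.vertexSet, x ∈ R → EdgeEnds.Spans s t Finset.univ R :=
    fun R hR v => ⟨x, hR, hjoin v x⟩
  have htree : (EdgeEnds.rootedForests s t Finset.univ {x}).Nonempty := by
    obtain ⟨T, -, hT⟩ := (hspan {x} (by simp)).exists_isRootedForest
    exact ⟨T, EdgeEnds.mem_rootedForests_univ.2 hT⟩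
  have htwo : (EdgeEnds.twoForestFinset s t).Nonempty := by
    obtain ⟨T, -, hT⟩ := (hspan ({x, y} : Finset G.vertexSet) (by simp)).exists_isRootedForest
    exact ⟨T, EdgeEnds.mem_twoForestFinset.2 ⟨x, y, hxy, hT⟩⟩
  refine ⟨?_, TwoForest.avgDegree_eq hst, ?_⟩
  · rw [TwoForest.twoForests_eq_image hst]
    exact (Finset.coe_nonempty.2 htwo).image _
  · rw [TwoForest.expectedCutSize_eq hst, TwoForest.avgDegree_eq hst,
      EdgeEnds.sum_card_cut hne x, div_le_iff₀ (by exact_mod_cast htwo.card_pos)]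
    have hbound := EdgeEnds.card_sub_one_sq_mul_le hne htree
    have hn : (2 : ℝ) ≤ Fintype.card G.vertexSet := by exact_mod_cast hcard
    set n : ℝ := (Fintype.card G.vertexSet : ℝ)
    have h1 : 0 < n - 1 := by linarith
    rw [Nat.cast_mul, Nat.cast_sub (by omega), Nat.cast_one]
    -- The factor 1 + 1/(n - 1) = n/(n - 1) cancels the n of the average degree, leaving the
    -- constant 4 of the main inequality.
    have h2 : 2 * (2 * (Fintype.card G.edgeSet : ℝ) / n) * (1 + 1 / (n - 1)) =
        4 * Fintype.card G.edgeSet / (n - 1) := by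
      field_simp
      ring
    rw [h2, div_mul_eq_mul_div, le_div_iff₀ h1]
    calc _ = (n - 1) ^ 2 * (EdgeEnds.rootedForests s t Finset.univ {x}).card := by ring
      _ ≤ _ := hbound
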